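/- **Theorem.** Let $r$ be an odd integer. Then there is no $Q$-polynomial (symmetric) association scheme with Krein array $$\{2r^2-1,\ 2r^2-2,\ r^2+1;\ 1,\ 2,\ r^2-1\}.$$ Here a (symmetric) association scheme of $D$ classes is a finite set $X$ with non-empty relations $R_0,\dots,R_D\subseteq X\times X$ whose adjacency matrices $A_0,\dots,A_D$ are symmetric and satisfy $A_0=I$, $\sum_i A_i=J$ (the all-one matrix) and $A_iA_j=\sum_k p_{ij}^kA_k$ with non-negative integers $p_{ij}^k$. Let $E_0=\frac1{|X|}J,E_1,\dots,E_D$ be the basis of primitive idempotents of the real algebra spanned by the $A_i$. The second eigenmatrix $Q$ and the Krein parameters $q_{ij}^k$ are defined by $E_i=\frac1{|X|}\sum_j Q_{ji}A_j$ and $E_i\circ E_j=\frac1{|X|}\sum_k q_{ij}^kE_k$, where $\circ$ is the entrywise product. The ordering $E_1,\dots,E_D$ is $Q$-polynomial if for each $0\le i\le D$ there is a polynomial $v_i^*$ of degree $i$ with $Q_{ji}=v_i^*(Q_{j1})$ for all $0\le j\le D$. The scheme is $Q$-polynomial with Krein array $\{b_0^*,\dots,b_{D-1}^*;c_1^*,\dots,c_D^*\}$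 if some $Q$-polynomial ordering satisfies $b_i^*=q_{1,i+1}^i$ and $c_{i+1}^*=q_{1,i}^{i+1}$ for $0\le i<D$. For the array above, $D=3$. -/

import Mathlib

open scoped Matrix

noncomputable section

/-- The adjacency matrix, over the reals, of the (di)graph `(X, R)`. -/
def relMatrix {X : Type*} (R : Set (X × X)) : Matrix X X ℝ :=
  Matrix.of fun x y => R.indicator (fun _ => (1 : ℝ)) (x, y)

/-- A (symmetric) association scheme of `D` classes on the finite vertex set `X`. -/
structure AssociationScheme (X : Type*) [Fintype X] [DecidableEq X] (D : ℕ) where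
  /-- The relations `R₀, …, R_D`. -/
  rel : Fin (D + 1) → Set (X × X)
  rel_nonempty : ∀ i, (rel i).Nonempty
  relMatrix_zero : relMatrix (rel 0) = 1
  sum_relMatrix : ∑ i, relMatrix (rel i) = Matrix.of fun _ _ => (1 : ℝ)
  transpose_relMatrix : ∀ i, (relMatrix (rel i))ᵀ = relMatrix (rel i)
  exists_intersectionNumbers : ∃ p : Fin (D + 1) → Fin (D + 1) → Fin (D + 1) → ℕ,
    ∀ i j, relMatrix (rel i) * relMatrix (rel j) = ∑ k, (p i j k : ℝ) • relMatrix (rel k)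

namespace AssociationScheme

variable {X : Type*} [Fintype X] [DecidableEq X] {D : ℕ}

/-- The adjacency matrix `A i` of the `i`-th relation. -/
def A (S : AssociationScheme X D) (i : Fin (D + 1)) : Matrix X X ℝ :=
  relMatrix (S.rel i)

/-- The real span of the adjacency matrices (the Bose-Mesner algebra). -/
def algebraSpan (S : AssociationScheme X D) : Submodule ℝ (Matrix X X ℝ) :=
  Submodule.span ℝ (Set.range S.A)

/-- A primitive idempotent of the Bose-Mesner algebra: a nonzero idempotent in it that is not
the sum of two nonzero orthogonal idempotents in it. -/
structure IsPrimitiveIdempotent (S : AssociationScheme X D) (e : Matrix X X ℝ) : Prop where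
  mem : e ∈ S.algebraSpan
  ne_zero : e ≠ 0
  idem : e * e = e
  indecomposable : ∀ f ∈ S.algebraSpan, ∀ g ∈ S.algebraSpan,
    f * f = f → g * g = g → f * g = 0 → g * f = 0 → e = f + g → f = 0 ∨ g = 0

/-- `E 0, …, E D` is the basis of primitive idempotents of the Bose-Mesner algebra, listed in
some order with `E 0 = |X|⁻¹ J`. -/
structure IsPrimitiveBasis (S : AssociationScheme X D)
    (E : Fin (D + 1) → Matrix X X ℝ) : Prop where
  linearIndependent : LinearIndependent ℝ E
  span_eq : Submodule.span ℝ (Set.range E) = S.algebraSpan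
  primitive : ∀ i, S.IsPrimitiveIdempotent (E i)
  zero_eq : E 0 = (Fintype.card X : ℝ)⁻¹ • Matrix.of fun _ _ => (1 : ℝ)

/-- `Q` is the second eigenmatrix with respect to the ordering `E`:
`E i = |X|⁻¹ ∑ j, Q j i • A j`. -/
def IsSecondEigenmatrix (S : AssociationScheme X D) (E : Fin (D + 1) → Matrix X X ℝ)
    (Q : Matrix (Fin (D + 1)) (Fin (D + 1)) ℝ) : Prop :=
  ∀ i, E i = (Fintype.card X : ℝ)⁻¹ • ∑ j, Q j i • S.A j

/-- The ordering `E` of the primitive idempotents is `Q`-polynomial: for each `i` there is a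
polynomial `v` of degree `i` with `Q j i = v (Q j 1)` for all `j`. -/
def IsQPolynomialOrdering (S : AssociationScheme X D)
    (E : Fin (D + 1) → Matrix X X ℝ) : Prop :=
  S.IsPrimitiveBasis E ∧
    ∃ Q : Matrix (Fin (D + 1)) (Fin (D + 1)) ℝ, S.IsSecondEigenmatrix E Q ∧
      ∀ i : Fin (D + 1), ∃ v : Polynomial ℝ, v.degree = ((i : ℕ) : WithBot ℕ) ∧
        ∀ j, Q j i = v.eval (Q j 1)

/-- `q i j k` is the Krein parameter `q_{ij}^k` with respect to the ordering `E`: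
`E i ∘ E j = |X|⁻¹ ∑ k, q i j k • E k`, with the entrywise product on the left. -/
def IsKreinParameters (E : Fin (D + 1) → Matrix X X ℝ)
    (q : Fin (D + 1) → Fin (D + 1) → Fin (D + 1) → ℝ) : Prop :=
  ∀ i j, Matrix.hadamard (E i) (E j) = (Fintype.card X : ℝ)⁻¹ • ∑ k, q i j k • E k

/-- `S` is `Q`-polynomial with Krein array `{b 0, …, b (D-1); c 0, …, c (D-1)}`: for some
`Q`-polynomial ordering of its primitive idempotents, `b i = q_{1,i+1}^i` and
`c i = q_{1,i}^{i+1}` for `0 ≤ i < D` (so `c i` is the entry usually written `c*_{i+1}`). -/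
def IsQPolynomialWithKreinArray (S : AssociationScheme X D) (b c : Fin D → ℝ) : Prop :=
  ∃ E : Fin (D + 1) → Matrix X X ℝ, S.IsQPolynomialOrdering E ∧
    ∃ q : Fin (D + 1) → Fin (D + 1) → Fin (D + 1) → ℝ, IsKreinParameters E q ∧
      ∀ i : Fin D, q 1 i.succ i.castSucc = b i ∧ q 1 i.castSucc i.succ = c i

end AssociationScheme

end

open Finset

/-! The array and the column sums of the Krein parameters force q₁₁¹ = q₁₁³ = 0. A vanishing
q_{ij}^k gives ∑ₓ Eᵢ(u,x)Eⱼ(v,x)Eₖ(w,x) = 0 for all u, v, w, because the sum of the squares of these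
expressions is a multiple of q_{ij}^k (`sum_sq_triple_eq_tripleSum`, `krein_mul_trace`).

The array also gives |X| = 4r⁴ and |X|E₁ = -J + 2rs, where s is an integer matrix with diagonal r
and off-diagonal entries 0, ±1. The two vanishing families become formulas for ∑ₓ s(u,x)s(v,x)s(w,x)
and ∑ₓ s(u,x)s(v,x)s(w,x)² (`signed_matrix_identities`). These sums agree mod 2, so for odd r each
s(u,v) + s(u,w) + s(v,w) is odd. Counting nonzero entries in one or two rows then contradicts the
row norm 2r⁴ (`no_signed_matrix`). -/

/-! ### Triple products of projections. -/

/-- The sum of the entries of `L ∘ M ∘ N`. -/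
def tripleSum {X : Type*} [Fintype X] (L M N : Matrix X X ℝ) : ℝ :=
  ∑ x, ∑ y, L x y * M x y * N x y

theorem tripleSum_right_comm {X : Type*} [Fintype X] (L M N : Matrix X X ℝ) :
    tripleSum L M N = tripleSum L N M := by
  unfold tripleSum
  exact sum_congr rfl fun x _ => sum_congr rfl fun y _ => mul_right_comm _ _ _

/-- Expand each square as a double sum over x, y. The sums over u, v, w then factor, and KᵀK = K
collapses each factor to K(x,y). -/
theorem sum_sq_triple_eq_tripleSum {X : Type*} [Fintype X] {L M N : Matrix X X ℝ}
    (hL : Lᵀ * L = L) (hM : Mᵀ * M = M) (hN : Nᵀ * N = N) :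
    ∑ u, ∑ v, ∑ w, (∑ x, L u x * M v x * N w x) ^ 2 = tripleSum L M N := by
  have e : ∀ {K : Matrix X X ℝ}, Kᵀ * K = K → ∀ x y, K x y = ∑ u, K u x * K u y := by
    intro K hK x y
    conv_lhs => rw [← hK]
    rfl
  have key : ∀ u v w, (∑ x, L u x * M v x * N w x) ^ 2
      = ∑ x, ∑ y, (L u x * L u y) * (M v x * M v y) * (N w x * N w y) := by
    intro u v w
    rw [sq, sum_mul_sum]
    exact sum_congr rfl fun x _ => sum_congr rfl fun y _ => by ring
  have comm : ∀ f : X → X → X → ℝ, ∑ u, ∑ x, ∑ y, f u x y = ∑ x, ∑ y, ∑ u, f u x y := by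
    intro f
    rw [sum_comm]
    exact sum_congr rfl fun x _ => sum_comm
  have key₁ : ∀ u v, _ := fun u v => (sum_congr rfl fun w _ => key u v w).trans (comm _)
  have key₂ : ∀ u, _ := fun u => (sum_congr rfl fun v _ => key₁ u v).trans (comm _)
  rw [(sum_congr rfl fun u _ => key₂ u).trans (comm _), tripleSum]
  refine sum_congr rfl fun x _ => sum_congr rfl fun y _ => ?_
  rw [e hL x y, e hM x y, e hN x y, sum_mul_sum, sum_mul]
  refine sum_congr rfl fun u _ => ?_
  rw [sum_mul]
  exact sum_congr rfl fun v _ => (mul_sum _ _ _).symm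

theorem sum_triple_eq_zero {X : Type*} [Fintype X] {L M N : Matrix X X ℝ}
    (hL : Lᵀ * L = L) (hM : Mᵀ * M = M) (hN : Nᵀ * N = N) (h : tripleSum L M N = 0)
    (u v w : X) : ∑ x, L u x * M v x * N w x = 0 := by
  rw [← sum_sq_triple_eq_tripleSum hL hM hN] at h
  have h1 := (sum_eq_zero_iff_of_nonneg (fun _ _ => by positivity)).1 h u (mem_univ u)
  have h2 := (sum_eq_zero_iff_of_nonneg (fun _ _ => by positivity)).1 h1 v (mem_univ v)
  have h3 := (sum_eq_zero_iff_of_nonneg (fun _ _ => by positivity)).1 h2 w (mem_univ w)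
  exact pow_eq_zero_iff two_ne_zero |>.1 h3

/-! ### The Bose–Mesner algebra and its idempotents. -/

namespace AssociationScheme

variable {X : Type*} [Fintype X] [DecidableEq X] {D : ℕ}

theorem nonempty (S : AssociationScheme X D) : Nonempty X :=
  let ⟨p, _⟩ := S.rel_nonempty 0
  ⟨p.1⟩

theorem exists_A_apply (S : AssociationScheme X D) (x y : X) :
    ∃ j, ∀ i, S.A i x y = if i = j then 1 else 0 := by
  have h01 : ∀ i, S.A i x y = 0 ∨ S.A i x y = 1 := by
    intro i
    by_cases h : (x, y) ∈ S.rel i <;> simp [A, relMatrix, h]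
  have hsum : ∑ i, S.A i x y = 1 := by
    have := congrFun (congrFun S.sum_relMatrix x) y
    simpa [Matrix.sum_apply, A] using this
  have hex : ∃ j, S.A j x y = 1 := by
    by_contra! hne
    rw [sum_eq_zero fun i _ => (h01 i).resolve_right (hne i)] at hsum
    exact zero_ne_one hsum
  obtain ⟨j, hj⟩ := hex
  refine ⟨j, fun i => ?_⟩
  split_ifs with hij
  · rw [hij, hj]
  · rw [← add_sum_erase _ _ (mem_univ j), hj, add_eq_left] at hsum
    refine (sum_eq_zero_iff_of_nonneg fun k _ => ?_).1 hsum i (by simp [hij])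
    rcases h01 k with h | h <;> simp [h]

theorem exists_eigenmatrix_row (S : AssociationScheme X D) {E : Fin (D + 1) → Matrix X X ℝ}
    {Q : Matrix (Fin (D + 1)) (Fin (D + 1)) ℝ} (hQ : S.IsSecondEigenmatrix E Q) (x y : X) :
    ∃ j, ∀ i, (Fintype.card X : ℝ) * E i x y = Q j i := by
  obtain ⟨j, hj⟩ := S.exists_A_apply x y
  have := S.nonempty
  refine ⟨j, fun i => ?_⟩
  rw [hQ i, Matrix.smul_apply, smul_eq_mul, mul_inv_cancel_left₀ (by simp)]
  simp [Matrix.sum_apply, hj]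

theorem eigenmatrix_diag (S : AssociationScheme X D) {E : Fin (D + 1) → Matrix X X ℝ}
    {Q : Matrix (Fin (D + 1)) (Fin (D + 1)) ℝ} (hQ : S.IsSecondEigenmatrix E Q) (x : X)
    (i : Fin (D + 1)) : (Fintype.card X : ℝ) * E i x x = Q 0 i := by
  obtain ⟨j, hj⟩ := S.exists_A_apply x x
  have h0 : S.A 0 x x = 1 := by rw [A, S.relMatrix_zero, Matrix.one_apply_eq]
  obtain rfl : (0 : Fin (D + 1)) = j := by
    by_contra h
    rw [hj, if_neg h] at h0
    exact zero_ne_one h0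
  have := S.nonempty
  rw [hQ i, Matrix.smul_apply, smul_eq_mul, mul_inv_cancel_left₀ (by simp)]
  simp [Matrix.sum_apply, hj]

theorem trace_eq (S : AssociationScheme X D) {E : Fin (D + 1) → Matrix X X ℝ}
    {Q : Matrix (Fin (D + 1)) (Fin (D + 1)) ℝ} (hQ : S.IsSecondEigenmatrix E Q)
    (i : Fin (D + 1)) : (E i).trace = Q 0 i := by
  have hn : (Fintype.card X : ℝ) ≠ 0 := by
    have := S.nonempty
    simp
  have h : ∀ x, E i x x = (Fintype.card X : ℝ)⁻¹ * Q 0 i := fun x => by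
    rw [← S.eigenmatrix_diag hQ x i, inv_mul_cancel_left₀ hn]
  simp [Matrix.trace, h, hn]

theorem A_mem (S : AssociationScheme X D) (i : Fin (D + 1)) : S.A i ∈ S.algebraSpan :=
  Submodule.subset_span ⟨i, rfl⟩

theorem one_mem (S : AssociationScheme X D) : (1 : Matrix X X ℝ) ∈ S.algebraSpan := by
  rw [← S.relMatrix_zero]
  exact S.A_mem 0

theorem mul_mem (S : AssociationScheme X D) {M N : Matrix X X ℝ} (hM : M ∈ S.algebraSpan)
    (hN : N ∈ S.algebraSpan) : M * N ∈ S.algebraSpan := by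
  obtain ⟨p, hp⟩ := S.exists_intersectionNumbers
  unfold algebraSpan at hM hN
  induction hM using Submodule.span_induction with
  | zero => simp
  | add a b _ _ ha hb => rw [add_mul]; exact add_mem ha hb
  | smul c a _ ha => rw [smul_mul_assoc]; exact Submodule.smul_mem _ _ ha
  | mem a ha =>
    obtain ⟨i, rfl⟩ := ha
    induction hN using Submodule.span_induction with
    | zero => simp
    | add a b _ _ ha hb => rw [mul_add]; exact add_mem ha hb
    | smul c a _ ha => rw [mul_smul_comm]; exact Submodule.smul_mem _ _ ha
    | mem a ha =>
      obtain ⟨j, rfl⟩ := ha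
      rw [A, A, hp]
      exact sum_mem fun k _ => Submodule.smul_mem _ _ (S.A_mem k)

theorem transpose_eq (S : AssociationScheme X D) {M : Matrix X X ℝ} (hM : M ∈ S.algebraSpan) :
    Mᵀ = M := by
  unfold algebraSpan at hM
  induction hM using Submodule.span_induction with
  | zero => simp
  | add a b _ _ ha hb => rw [Matrix.transpose_add, ha, hb]
  | smul c a _ ha => rw [Matrix.transpose_smul, ha]
  | mem a ha =>
    obtain ⟨i, rfl⟩ := ha
    exact S.transpose_relMatrix i

theorem mul_comm_of_mem (S : AssociationScheme X D) {M N : Matrix X X ℝ}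
    (hM : M ∈ S.algebraSpan) (hN : N ∈ S.algebraSpan) : M * N = N * M := by
  rw [← S.transpose_eq (S.mul_mem hM hN), Matrix.transpose_mul, S.transpose_eq hM,
    S.transpose_eq hN]

/-- The algebra is commutative, so e = ef + (e - ef) splits e into orthogonal idempotents, and
primitivity kills one of them. -/
theorem IsPrimitiveIdempotent.mul_eq_zero_or (S : AssociationScheme X D) {e f : Matrix X X ℝ}
    (he : S.IsPrimitiveIdempotent e) (hf : S.IsPrimitiveIdempotent f) :
    e * f = 0 ∨ e * f = e := by
  have hc := S.mul_comm_of_mem he.mem hf.mem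
  have hidem : e * f * (e * f) = e * f := by
    rw [mul_assoc, ← mul_assoc f, ← hc, mul_assoc e f f, hf.idem, ← mul_assoc, he.idem]
  have hl : e * (e * f) = e * f := by rw [← mul_assoc, he.idem]
  have hr : e * f * e = e * f := by rw [mul_assoc, ← hc, hl]
  have := he.indecomposable (e * f) (S.mul_mem he.mem hf.mem) (e - e * f)
    (sub_mem he.mem (S.mul_mem he.mem hf.mem)) hidem
    (by rw [mul_sub, sub_mul, sub_mul, he.idem, hl, hr, hidem]; abel)
    (by rw [mul_sub, hr, hidem, sub_self]) (by rw [sub_mul, hl, hidem, sub_self]) (by abel)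
  exact this.imp id fun h => (sub_eq_zero.1 h).symm

/-! ### Orthogonality relations and Krein parameters. -/

namespace IsPrimitiveBasis

variable {S : AssociationScheme X D} {E : Fin (D + 1) → Matrix X X ℝ}

theorem transpose_eq (hE : S.IsPrimitiveBasis E) (i : Fin (D + 1)) : (E i)ᵀ = E i :=
  S.transpose_eq (hE.primitive i).mem

theorem transpose_mul_self (hE : S.IsPrimitiveBasis E) (i : Fin (D + 1)) :
    (E i)ᵀ * E i = E i := by
  rw [hE.transpose_eq, (hE.primitive i).idem]

theorem mul_eq_zero (hE : S.IsPrimitiveBasis E) {i j : Fin (D + 1)} (hij : i ≠ j) :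
    E i * E j = 0 := by
  rcases (hE.primitive i).mul_eq_zero_or S (hE.primitive j) with h | h
  · exact h
  rcases (hE.primitive j).mul_eq_zero_or S (hE.primitive i) with h' | h'
  · rw [S.mul_comm_of_mem (hE.primitive i).mem (hE.primitive j).mem, h']
  · rw [S.mul_comm_of_mem (hE.primitive j).mem (hE.primitive i).mem, h] at h'
    exact absurd (hE.linearIndependent.injective h') hij

theorem sum_eq_one (hE : S.IsPrimitiveBasis E) : ∑ i, E i = 1 := by
  have h1 : (1 : Matrix X X ℝ) ∈ Submodule.span ℝ (Set.range E) := by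
    rw [hE.span_eq]
    exact S.one_mem
  obtain ⟨c, hc⟩ := (Submodule.mem_span_range_iff_exists_fun ℝ).1 h1
  have h : ∀ i, c i • E i = E i := by
    intro i
    have := congrArg (· * E i) hc
    simp only [sum_mul, one_mul, smul_mul_assoc] at this
    rwa [sum_eq_single i (fun j _ hj => by rw [hE.mul_eq_zero hj, smul_zero]) (by simp),
      (hE.primitive i).idem] at this
  rw [← hc]
  exact sum_congr rfl fun i _ => (h i).symm

theorem zero_apply (hE : S.IsPrimitiveBasis E) (x y : X) :
    E 0 x y = (Fintype.card X : ℝ)⁻¹ := by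
  simp [hE.zero_eq]

theorem apply_comm (hE : S.IsPrimitiveBasis E) (i : Fin (D + 1)) (x y : X) :
    E i x y = E i y x :=
  congrFun (congrFun (hE.transpose_eq i) y) x

theorem sum_mul_apply (hE : S.IsPrimitiveBasis E) (i j : Fin (D + 1)) (u v : X) :
    ∑ x, E i u x * E j v x = if i = j then E i u v else 0 := by
  have : ∑ x, E i u x * E j v x = (E i * E j) u v := by
    rw [Matrix.mul_apply]
    exact sum_congr rfl fun x _ => by rw [hE.apply_comm j v x]
  rw [this]
  split_ifs with h
  · subst h
    rw [(hE.primitive i).idem]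
  · rw [hE.mul_eq_zero h, Matrix.zero_apply]

theorem sum_sum_mul_apply (hE : S.IsPrimitiveBasis E) (i j : Fin (D + 1)) :
    ∑ x, ∑ y, E i x y * E j x y = if i = j then (E i).trace else 0 := by
  simp_rw [hE.sum_mul_apply]
  split_ifs <;> simp [Matrix.trace]

theorem trace_pos (hE : S.IsPrimitiveBasis E) (i : Fin (D + 1)) : 0 < (E i).trace := by
  have h := hE.sum_sum_mul_apply i i
  rw [if_pos rfl] at h
  rw [← h]
  refine lt_of_le_of_ne (sum_nonneg fun x _ => sum_nonneg fun y _ => mul_self_nonneg _) ?_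
  intro h0
  refine (hE.primitive i).ne_zero (Matrix.ext fun x y => ?_)
  have h1 := (sum_eq_zero_iff_of_nonneg
    fun x _ => sum_nonneg fun y _ => mul_self_nonneg _).1 h0.symm x (mem_univ x)
  have h2 := (sum_eq_zero_iff_of_nonneg fun y _ => mul_self_nonneg _).1 h1 y (mem_univ y)
  simpa using h2

theorem trace_zero (hE : S.IsPrimitiveBasis E) : (E 0).trace = 1 := by
  have := S.nonempty
  simp [Matrix.trace, hE.zero_apply]

/-- Pair Eᵢ ∘ Eⱼ with Eₖ in the entrywise inner product, for which the idempotents are orthogonal.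
The triple sum is symmetric, so the vanishing of a Krein parameter does not depend on the order of
its indices. -/
theorem krein_mul_trace (hE : S.IsPrimitiveBasis E)
    {q : Fin (D + 1) → Fin (D + 1) → Fin (D + 1) → ℝ} (hq : IsKreinParameters E q)
    (i j k : Fin (D + 1)) :
    q i j k * (E k).trace = Fintype.card X * tripleSum (E i) (E j) (E k) := by
  have hn : (Fintype.card X : ℝ) ≠ 0 := by
    have := S.nonempty
    simp
  have h : ∀ x y, E i x y * E j x y * E k x y
      = (Fintype.card X : ℝ)⁻¹ * ∑ l, q i j l * (E l x y * E k x y) := by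
    intro x y
    have := congrFun (congrFun (hq i j) x) y
    rw [Matrix.hadamard_apply] at this
    rw [this]
    simp [Matrix.sum_apply, mul_assoc, sum_mul]
  unfold tripleSum
  simp_rw [h, ← mul_sum]
  rw [mul_inv_cancel_left₀ hn]
  have hcomm : ∑ x, ∑ y, ∑ l, q i j l * (E l x y * E k x y)
      = ∑ l, q i j l * ∑ x, ∑ y, E l x y * E k x y := by
    simp_rw [mul_sum]
    rw [sum_comm (s := univ (α := Fin (D + 1)))]
    exact sum_congr rfl fun x _ => sum_comm
  rw [hcomm]
  simp [hE.sum_sum_mul_apply]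

/-- Since ∑ⱼ Eⱼ = I, summing over j restricts the triple sums to the diagonal, where |X|Eᵢ is
constant. -/
theorem sum_krein (hE : S.IsPrimitiveBasis E)
    {Q : Matrix (Fin (D + 1)) (Fin (D + 1)) ℝ} (hQ : S.IsSecondEigenmatrix E Q)
    {q : Fin (D + 1) → Fin (D + 1) → Fin (D + 1) → ℝ} (hq : IsKreinParameters E q)
    (i k : Fin (D + 1)) : ∑ j, q i j k = Q 0 i := by
  have hn : (Fintype.card X : ℝ) ≠ 0 := by
    have := S.nonempty
    simp
  refine mul_right_cancel₀ (hE.trace_pos k).ne' ?_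
  rw [sum_mul]
  simp_rw [hE.krein_mul_trace hq, ← mul_sum]
  have h : ∑ j, tripleSum (E i) (E j) (E k) = ∑ x, E i x x * E k x x := by
    unfold tripleSum
    rw [sum_comm]
    refine sum_congr rfl fun x _ => ?_
    rw [sum_comm]
    have h1 : ∀ y, ∑ j, E j x y = (1 : Matrix X X ℝ) x y := by
      intro y
      rw [← hE.sum_eq_one, Matrix.sum_apply]
    simp_rw [← sum_mul, ← mul_sum, h1, Matrix.one_apply]
    simp
  rw [h, mul_sum, Matrix.trace, mul_sum]
  refine sum_congr rfl fun x _ => ?_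
  rw [← S.eigenmatrix_diag hQ x i, Matrix.diag_apply, mul_assoc]

theorem krein_zero (hE : S.IsPrimitiveBasis E)
    {q : Fin (D + 1) → Fin (D + 1) → Fin (D + 1) → ℝ} (hq : IsKreinParameters E q)
    (i j : Fin (D + 1)) : q i j 0 = if i = j then (E i).trace else 0 := by
  have hn : (Fintype.card X : ℝ) ≠ 0 := by
    have := S.nonempty
    simp
  have h := hE.krein_mul_trace hq i j 0
  rw [hE.trace_zero, mul_one] at h
  rw [h, ← hE.sum_sum_mul_apply, tripleSum]
  simp_rw [hE.zero_apply, ← sum_mul]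
  field_simp

/-- The quadratic writes Eⱼ as a combination of Eᵢ ∘ Eᵢ, Eᵢ and E₀ with nonzero leading coefficient.
Pairing with Eₖ kills every term but the first. -/
theorem tripleSum_eq_zero (hE : S.IsPrimitiveBasis E)
    {Q : Matrix (Fin (D + 1)) (Fin (D + 1)) ℝ} (hQ : S.IsSecondEigenmatrix E Q)
    {i j k : Fin (D + 1)} (hk0 : k ≠ 0) (hki : k ≠ i) (hkj : k ≠ j)
    {v : Polynomial ℝ} (hv : v.degree = 2) (h : ∀ l, Q l j = v.eval (Q l i)) :
    tripleSum (E i) (E i) (E k) = 0 := by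
  have hn : (Fintype.card X : ℝ) ≠ 0 := by
    have := S.nonempty
    simp
  set n : ℝ := (Fintype.card X : ℝ)
  have ha : v.coeff 2 ≠ 0 := Polynomial.coeff_ne_zero_of_eq_degree hv
  have hv' := Polynomial.eq_quadratic_of_degree_le_two hv.le
  have hj : ∀ x y, E j x y
      = v.coeff 2 * n * (E i x y * E i x y) + v.coeff 1 * E i x y + v.coeff 0 * E 0 x y := by
    intro x y
    obtain ⟨l, hl⟩ := S.exists_eigenmatrix_row hQ x y
    have h1 := h l
    rw [← hl, ← hl, hv'] at h1
    simp only [Polynomial.eval_add, Polynomial.eval_mul, Polynomial.eval_C, Polynomial.eval_pow,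
      Polynomial.eval_X] at h1
    rw [hE.zero_apply]
    refine mul_left_cancel₀ hn (h1.trans ?_)
    rw [mul_add, mul_left_comm n (v.coeff 0), mul_inv_cancel₀ hn]
    ring
  have h2 := hE.sum_sum_mul_apply j k
  have h3 : ∑ x, ∑ y, E j x y * E k x y
      = v.coeff 2 * n * tripleSum (E i) (E i) (E k) + v.coeff 1 * (∑ x, ∑ y, E i x y * E k x y)
        + v.coeff 0 * ∑ x, ∑ y, E 0 x y * E k x y := by
    simp only [tripleSum, mul_sum, ← sum_add_distrib]
    refine sum_congr rfl fun x _ => sum_congr rfl fun y _ => ?_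
    rw [hj]
    ring
  rw [h3, hE.sum_sum_mul_apply, hE.sum_sum_mul_apply, if_neg hki.symm, if_neg hk0.symm,
    if_neg hkj.symm] at h2
  simpa [ha, hn] using h2

theorem krein_zero_right (hE : S.IsPrimitiveBasis E)
    {q : Fin (D + 1) → Fin (D + 1) → Fin (D + 1) → ℝ} (hq : IsKreinParameters E q)
    {i k : Fin (D + 1)} (hik : i ≠ k) : q i 0 k = 0 := by
  have h := hE.krein_mul_trace hq i 0 k
  have h0 : tripleSum (E i) (E 0) (E k) = 0 := by
    have := hE.sum_sum_mul_apply i k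
    rw [if_neg hik] at this
    rw [tripleSum_right_comm, tripleSum]
    simp_rw [hE.zero_apply, ← sum_mul]
    rw [this, zero_mul]
  rw [h0, mul_zero] at h
  exact (_root_.mul_eq_zero.1 h).resolve_right (hE.trace_pos k).ne'

end IsPrimitiveBasis

end AssociationScheme

/-! ### The parity contradiction. -/

theorem no_signed_matrix {X : Type*} [Fintype X] [DecidableEq X] [Nonempty X] {r : ℤ}
    (hr : Odd r) (hr1 : r ^ 2 ≠ 1) (hcard : (Fintype.card X : ℤ) = 4 * r ^ 4) (s : X → X → ℤ)
    (hdiag : ∀ x, s x x = r) (hoff : ∀ x y, x ≠ y → s x y = 0 ∨ s x y = 1 ∨ s x y = -1)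
    (hsymm : ∀ x y, s x y = s y x) (hsq : ∀ u, ∑ x, s u x ^ 2 = 2 * r ^ 4)
    (hT : ∀ u v w, ∑ x, s u x * s v x * s w x = r ^ 2 * (s u v + s u w + s v w) - r)
    (hW : ∀ u v w, ∑ x, s u x * s v x * s w x ^ 2
      = 2 * r ^ 2 * (s u w * s v w) + r * (r ^ 2 - 1) * s u v) : False := by
  -- The sums in `hT` and `hW` agree mod 2 because t² ≡ t. For odd r the coefficients 2r² and r(r² -
  -- 1) are even, so only r²(s u v + s u w + s v w) - r survives.
  have hpar : ∀ u v w, Odd (s u v + s u w + s v w) := by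
    intro u v w
    have h : Even (∑ x, s u x * s v x * s w x ^ 2 - ∑ x, s u x * s v x * s w x) := by
      rw [← sum_sub_distrib]
      refine even_sum _ fun x _ => ?_
      have : s u x * s v x * s w x ^ 2 - s u x * s v x * s w x
          = s u x * s v x * (s w x * (s w x - 1)) := by ring
      rw [this]
      exact (Int.even_mul_pred_self _).mul_left _
    rw [hT, hW] at h
    obtain ⟨k, rfl⟩ := hr
    obtain ⟨l, hl⟩ := h
    have h2 : Even ((2 * k + 1) * ((2 * k + 1) ^ 2 - 1) * s u v) :=
      ⟨(2 * k + 1) * (2 * k ^ 2 + 2 * k) * s u v, by ring⟩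
    obtain ⟨m, hm⟩ := h2
    rw [hm] at hl
    refine ⟨(2 * k + 1) ^ 2 * (s u w * s v w) + m - l + k
      - (2 * k ^ 2 + 2 * k) * (s u v + s u w + s v w), ?_⟩
    linear_combination -hl
  obtain ⟨u⟩ := ‹Nonempty X›
  by_cases hw : ∃ w, s u w = 0
  · obtain ⟨w, hw⟩ := hw
    have huw : u ≠ w := by
      rintro rfl
      rw [hdiag] at hw
      subst hw
      simp at hr
    -- With s u w = 0, parity makes exactly one of s u x, s w x nonzero for x ≠ u, w. Summing over x
    -- gives 4r⁴ = 4r⁴ + 2(r² - 1).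
    have hx : ∀ x, s u x ^ 2 + s w x ^ 2
        = 1 + ((if x = u then r ^ 2 - 1 else 0) + if x = w then r ^ 2 - 1 else 0) := by
      intro x
      by_cases hxu : x = u
      · subst hxu
        rw [hdiag, hsymm w x, hw]
        simp [huw]
      by_cases hxw : x = w
      · subst hxw
        rw [hdiag, hw]
        simp [hxu]
      have h := hpar u w x
      rw [hw] at h
      rcases hoff u x (Ne.symm hxu) with h1 | h1 | h1 <;>
        rcases hoff w x (Ne.symm hxw) with h2 | h2 | h2 <;>
        rw [h1, h2] at h ⊢ <;> simp [hxu, hxw] at h ⊢ <;> revert h <;> decide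
    have := sum_congr (rfl : (univ : Finset X) = univ) fun x _ => hx x
    rw [sum_add_distrib, hsq, hsq, sum_add_distrib, sum_add_distrib] at this
    simp [hcard] at this
    exact hr1 (by linarith)
  · push Not at hw
    -- A row without zeros has square norm 4r⁴ + r² - 1, which exceeds 2r⁴.
    have hx : ∀ x, s u x ^ 2 = 1 + if x = u then r ^ 2 - 1 else 0 := by
      intro x
      by_cases hxu : x = u
      · subst hxu
        rw [hdiag]
        simp
      rcases hoff u x (Ne.symm hxu) with h1 | h1 | h1
      · exact absurd h1 (hw x)
      all_goals simp [h1, hxu]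
    have := sum_congr (rfl : (univ : Finset X) = univ) fun x _ => hx x
    rw [hsq, sum_add_distrib] at this
    simp [hcard] at this
    have h0 : r ≠ 0 := by
      rintro rfl
      simp at hr
    have : 0 < r ^ 2 := by positivity
    nlinarith

/-- Here θ and ψ stand for |X|E₁ and |X|E₃. Expanding the hypotheses in s determines its moments one
after another, each from the lower ones; ψ involves s only through s², whence the mixed moment. -/
theorem signed_matrix_identities {X : Type*} [Fintype X] [DecidableEq X] {r : ℝ} (hr : r ≠ 0)
    (hcard : (Fintype.card X : ℝ) = 4 * r ^ 4) {s θ ψ : X → X → ℝ}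
    (hθ : ∀ x y, θ x y = -1 + 2 * r * s x y)
    (hψ : ∀ x y, ψ x y = 4 * r ^ 4 * (if x = y then 1 else 0) + (r ^ 2 - 1)
      - 2 * r ^ 2 * s x y ^ 2)
    (hdiag : ∀ x, s x x = r) (h0 : ∀ u, ∑ x, θ u x = 0)
    (h1 : ∀ u v, ∑ x, θ u x * θ v x = 4 * r ^ 4 * θ u v)
    (h2 : ∀ u w, ∑ x, θ u x * ψ w x = 0)
    (h3 : ∀ u v w, ∑ x, θ u x * θ v x * θ w x = 0)
    (h4 : ∀ u v w, ∑ x, θ u x * θ v x * ψ w x = 0) :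
    (∀ u, ∑ x, s u x ^ 2 = 2 * r ^ 4) ∧
    (∀ u v w, ∑ x, s u x * s v x * s w x = r ^ 2 * (s u v + s u w + s v w) - r) ∧
    ∀ u v w, ∑ x, s u x * s v x * s w x ^ 2
      = 2 * r ^ 2 * (s u w * s v w) + r * (r ^ 2 - 1) * s u v := by
  have hone : ∑ _x : X, (1 : ℝ) = 4 * r ^ 4 := by simp [hcard]
  have hs : ∀ u, ∑ x, s u x = 2 * r ^ 3 := by
    intro u
    have h : ∑ x, θ u x = 2 * r * ∑ x, s u x - ∑ _x : X, (1 : ℝ) := by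
      rw [mul_sum, ← sum_sub_distrib]
      exact sum_congr rfl fun x _ => by rw [hθ]; ring
    rw [h0, hone] at h
    refine mul_left_cancel₀ (mul_ne_zero two_ne_zero hr) ?_
    linear_combination -h
  have hss : ∀ u v, ∑ x, s u x * s v x = 2 * r ^ 3 * s u v := by
    intro u v
    have h : ∑ x, θ u x * θ v x = 4 * r ^ 2 * (∑ x, s u x * s v x) - 2 * r * (∑ x, s u x)
        - 2 * r * (∑ x, s v x) + ∑ _x : X, (1 : ℝ) := by
      simp only [mul_sum, ← sum_sub_distrib, ← sum_add_distrib]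
      exact sum_congr rfl fun x _ => by rw [hθ, hθ]; ring
    rw [h1, hone, hs, hs, hθ] at h
    refine mul_left_cancel₀ (mul_ne_zero four_ne_zero (pow_ne_zero 2 hr)) ?_
    linear_combination -h
  have hsq : ∀ u, ∑ x, s u x ^ 2 = 2 * r ^ 4 := by
    intro u
    have := hss u u
    rw [hdiag] at this
    simp_rw [sq]
    rw [this]
    ring
  have hssq : ∀ u w, ∑ x, s u x * s w x ^ 2 = r ^ 3 - r + 2 * r ^ 2 * s u w := by
    intro u w
    have h : ∑ x, θ u x * ψ w x = 4 * r ^ 4 * (∑ x, θ u x * if w = x then 1 else 0)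
        + (r ^ 2 - 1) * (∑ x, θ u x)
        - 4 * r ^ 3 * (∑ x, s u x * s w x ^ 2) + 2 * r ^ 2 * ∑ x, s w x ^ 2 := by
      simp only [mul_sum, ← sum_sub_distrib, ← sum_add_distrib]
      exact sum_congr rfl fun x _ => by rw [hψ, hθ]; ring
    simp only [mul_ite, mul_one, mul_zero, sum_ite_eq, mem_univ, if_true] at h
    rw [h2, h0, hsq, hθ] at h
    refine mul_left_cancel₀ (mul_ne_zero four_ne_zero (pow_ne_zero 3 hr)) ?_
    linear_combination h
  refine ⟨hsq, fun u v w => ?_, fun u v w => ?_⟩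
  · have h : ∑ x, θ u x * θ v x * θ w x = 8 * r ^ 3 * (∑ x, s u x * s v x * s w x)
        - 4 * r ^ 2 * (∑ x, s u x * s v x) - 4 * r ^ 2 * (∑ x, s u x * s w x)
        - 4 * r ^ 2 * (∑ x, s v x * s w x) + 2 * r * (∑ x, s u x) + 2 * r * (∑ x, s v x)
        + 2 * r * (∑ x, s w x) - ∑ _x : X, (1 : ℝ) := by
      simp only [mul_sum, ← sum_sub_distrib, ← sum_add_distrib]
      exact sum_congr rfl fun x _ => by rw [hθ, hθ, hθ]; ring
    rw [h3, hone] at h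
    simp only [hs, hss] at h
    refine mul_left_cancel₀ (mul_ne_zero (by norm_num : (8 : ℝ) ≠ 0) (pow_ne_zero 3 hr)) ?_
    linear_combination -h
  · have h : ∑ x, θ u x * θ v x * ψ w x
        = 4 * r ^ 4 * (∑ x, θ u x * θ v x * if w = x then 1 else 0)
        + (r ^ 2 - 1) * (∑ x, θ u x * θ v x) - 8 * r ^ 4 * (∑ x, s u x * s v x * s w x ^ 2)
        + 4 * r ^ 3 * (∑ x, s u x * s w x ^ 2) + 4 * r ^ 3 * (∑ x, s v x * s w x ^ 2)
        - 2 * r ^ 2 * ∑ x, s w x ^ 2 := by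
      simp only [mul_sum, ← sum_sub_distrib, ← sum_add_distrib]
      exact sum_congr rfl fun x _ => by rw [hψ, hθ, hθ]; ring
    simp only [mul_ite, mul_one, mul_zero, sum_ite_eq, mem_univ, if_true] at h
    rw [h4, h1, hsq, hssq, hssq, hθ, hθ, hθ] at h
    refine mul_left_cancel₀ (mul_ne_zero (by norm_num : (8 : ℝ) ≠ 0) (pow_ne_zero 4 hr)) ?_
    linear_combination h

/-! ### From the Krein array to the signed matrix. -/

theorem mainTheorem3 (r : ℤ) (hr : Odd r) (X : Type*) [Fintype X] [DecidableEq X] :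
    ¬ ∃ S : AssociationScheme X 3,
      S.IsQPolynomialWithKreinArray
        ![2 * (r : ℝ) ^ 2 - 1, 2 * (r : ℝ) ^ 2 - 2, (r : ℝ) ^ 2 + 1]
        ![1, 2, (r : ℝ) ^ 2 - 1] := by
  rintro ⟨S, E, ⟨hE, Q, hQ, hpoly⟩, q, hq, hbc⟩
  have := S.nonempty
  have hn : (Fintype.card X : ℝ) ≠ 0 := by simp
  have hr0 : (r : ℝ) ≠ 0 := by
    rw [Int.cast_ne_zero]
    rintro rfl
    simp at hr
  obtain ⟨hb0, hc0⟩ : q 1 1 0 = 2 * (r : ℝ) ^ 2 - 1 ∧ q 1 0 1 = 1 := hbc 0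
  obtain ⟨hb1, hc1⟩ : q 1 2 1 = 2 * (r : ℝ) ^ 2 - 2 ∧ q 1 1 2 = 2 := hbc 1
  obtain ⟨hb2, hc2⟩ : q 1 3 2 = (r : ℝ) ^ 2 + 1 ∧ q 1 2 3 = (r : ℝ) ^ 2 - 1 := hbc 2
  have hQ1 : Q 0 1 = 2 * (r : ℝ) ^ 2 - 1 := by
    rw [← S.trace_eq hQ, ← hb0, hE.krein_zero hq, if_pos rfl]
  obtain ⟨v, hv, hvQ⟩ := hpoly 2
  have ht113 : tripleSum (E 1) (E 1) (E 3) = 0 :=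
    hE.tripleSum_eq_zero hQ (j := 2) (by decide) (by decide) (by decide) hv hvQ
  have hq113 : q 1 1 3 = 0 := by
    have h := hE.krein_mul_trace hq 1 1 3
    rw [ht113, mul_zero] at h
    exact (mul_eq_zero.1 h).resolve_right (hE.trace_pos 3).ne'
  have hq131 : q 1 3 1 = 0 := by
    have h := hE.krein_mul_trace hq 1 3 1
    rw [tripleSum_right_comm, ht113, mul_zero] at h
    exact (mul_eq_zero.1 h).resolve_right (hE.trace_pos 1).ne'
  have hq111 : q 1 1 1 = 0 := by
    have h := hE.sum_krein hQ hq 1 1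
    rw [Fin.sum_univ_four, hc0, hb1, hq131, hQ1] at h
    linear_combination h
  have ht111 : tripleSum (E 1) (E 1) (E 1) = 0 := by
    have h := hE.krein_mul_trace hq 1 1 1
    rw [hq111, zero_mul] at h
    exact (mul_eq_zero.1 h.symm).resolve_left hn
  have hq122 : q 1 2 2 = (r : ℝ) ^ 2 - 4 := by
    have h := hE.sum_krein hQ hq 1 2
    rw [Fin.sum_univ_four, hE.krein_zero_right hq (by decide), hc1, hb2, hQ1] at h
    linear_combination h
  have hq120 : q 1 2 0 = 0 := by
    rw [hE.krein_zero hq, if_neg (by decide)]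
  set n : ℝ := (Fintype.card X : ℝ) with hn_def
  set F : Fin 4 → X → X → ℝ := fun i x y => n * E i x y with hF
  have hF0 : ∀ x y, F 0 x y = 1 := fun x y => by
    simp only [hF, hE.zero_apply]
    exact mul_inv_cancel₀ hn
  have hFsum : ∀ x y, F 0 x y + F 1 x y + F 2 x y + F 3 x y = n * if x = y then 1 else 0 := by
    intro x y
    have h := congrFun (congrFun hE.sum_eq_one x) y
    rw [Matrix.sum_apply, Fin.sum_univ_four, Matrix.one_apply] at h
    rw [← h]
    simp only [hF]
    ring
  have hFmul : ∀ i j x y, F i x y * F j x y = ∑ k, q i j k * F k x y := by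
    intro i j x y
    have h := congrFun (congrFun (hq i j) x) y
    rw [Matrix.hadamard_apply] at h
    have h' : F i x y * F j x y = n * n * (E i x y * E j x y) := by simp only [hF]; ring
    rw [h', h]
    simp only [Matrix.smul_apply, Matrix.sum_apply, smul_eq_mul]
    rw [mul_assoc, mul_inv_cancel_left₀ hn, mul_sum]
    exact sum_congr rfl fun k _ => by simp only [hF]; ring
  have hF2 : ∀ x y, F 2 x y = (F 1 x y ^ 2 - (2 * (r : ℝ) ^ 2 - 1)) / 2 := by
    intro x y
    have h := hFmul 1 1 x y
    rw [Fin.sum_univ_four, hb0, hq111, hc1, hq113, hF0] at h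
    linear_combination -h / 2
  have hF12 : ∀ x y, F 1 x y * F 2 x y = (2 * (r : ℝ) ^ 2 - 2) * F 1 x y
      + ((r : ℝ) ^ 2 - 4) * F 2 x y
      + ((r : ℝ) ^ 2 - 1) * (n * (if x = y then 1 else 0) - 1 - F 1 x y - F 2 x y) := by
    intro x y
    have h := hFmul 1 2 x y
    rw [Fin.sum_univ_four, hq120, hb1, hq122, hc2] at h
    rw [h, ← hFsum, hF0]
    ring
  have hFdiag : ∀ x, F 1 x x = 2 * (r : ℝ) ^ 2 - 1 := fun x =>
    (S.eigenmatrix_diag hQ x 1).trans hQ1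
  obtain ⟨x₀⟩ := S.nonempty
  -- If r² = 1, the formula for `F 2` gives 0 on the diagonal, although E₂ has positive trace.
  have hr1 : (r : ℝ) ^ 2 - 1 ≠ 0 := by
    intro h
    have h2 : 0 < F 2 x₀ x₀ := by
      rw [show F 2 x₀ x₀ = Q 0 2 from S.eigenmatrix_diag hQ x₀ 2, ← S.trace_eq hQ]
      exact hE.trace_pos 2
    rw [hF2, hFdiag] at h2
    have : ((2 * (r : ℝ) ^ 2 - 1) ^ 2 - (2 * (r : ℝ) ^ 2 - 1)) / 2 = 0 := by
      linear_combination (2 * (r : ℝ) ^ 2 - 1) * h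
    linarith
  have hn4 : n = 4 * (r : ℝ) ^ 4 := by
    have h := hF12 x₀ x₀
    rw [hF2, hFdiag, if_pos rfl] at h
    refine mul_left_cancel₀ hr1 ?_
    linear_combination -h
  -- Off the diagonal, eliminating `F 2` from `hF12` leaves a cubic in `F 1 x y + 1` with roots 0
  -- and ±2r.
  have hex : ∀ x y, ∃ s : ℤ, F 1 x y = -1 + 2 * r * s ∧ (x = y → s = r) ∧
      (x ≠ y → s = 0 ∨ s = 1 ∨ s = -1) := by
    intro x y
    by_cases hxy : x = y
    · subst hxy
      refine ⟨r, ?_, fun _ => rfl, fun h => absurd rfl h⟩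
      rw [hFdiag]
      ring
    have h := hF12 x y
    rw [hF2, if_neg hxy] at h
    have h' : (F 1 x y + 1) * ((F 1 x y + 1 - 2 * r) * (F 1 x y + 1 + 2 * r)) = 0 := by
      linear_combination 2 * h
    rcases mul_eq_zero.1 h' with h' | h'
    · exact ⟨0, by push_cast; linarith, fun h => absurd h hxy, fun _ => by simp⟩
    rcases mul_eq_zero.1 h' with h' | h'
    · exact ⟨1, by push_cast; linarith, fun h => absurd h hxy, fun _ => by simp⟩
    · exact ⟨-1, by push_cast; linarith, fun h => absurd h hxy, fun _ => by simp⟩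
  choose s hs hsdiag hsoff using hex
  have hsum : ∀ i j u v, ∑ x, F i u x * F j v x = if i = j then n * F i u v else 0 := by
    intro i j u v
    have h : ∑ x, F i u x * F j v x = n * n * ∑ x, E i u x * E j v x := by
      rw [mul_sum]
      exact sum_congr rfl fun x _ => by simp only [hF]; ring
    rw [h, hE.sum_mul_apply]
    split_ifs
    · simp only [hF]; ring
    · simp
  have htriple : ∀ k, tripleSum (E 1) (E 1) (E k) = 0 →
      ∀ u v w, ∑ x, F 1 u x * F 1 v x * F k w x = 0 := by
    intro k hk u v w
    have h := sum_triple_eq_zero (hE.transpose_mul_self 1) (hE.transpose_mul_self 1)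
      (hE.transpose_mul_self k) hk u v w
    rw [← mul_zero (n * n * n), ← h, mul_sum]
    exact sum_congr rfl fun x _ => by simp only [hF]; ring
  obtain ⟨hsq, hT, hW⟩ := signed_matrix_identities (s := fun x y => (s x y : ℝ)) (θ := F 1)
    (ψ := F 3) hr0 hn4 hs
    (fun x y => by
      have h := hFsum x y
      rw [hF0, hF2, hs, hn4] at h
      linear_combination h)
    (fun x => by rw [hsdiag x x rfl])
    (fun u => by simpa [hF0] using hsum 1 0 u u)
    (fun u v => by rw [hsum, if_pos rfl, hn4])
    (fun u w => by rw [hsum, if_neg (by decide)])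
    (htriple 1 ht111) (htriple 3 ht113)
  refine no_signed_matrix hr (fun h => hr1 ?_) ?_ s (fun x => hsdiag x x rfl) hsoff
    (fun x y => ?_) (fun u => ?_) (fun u v w => ?_) fun u v w => ?_
  · rw [← Int.cast_pow, h, Int.cast_one, sub_self]
  · rw [hn_def] at hn4
    exact_mod_cast hn4
  · have h : F 1 x y = F 1 y x := by simp only [hF, hE.apply_comm 1 x y]
    rw [hs, hs] at h
    exact_mod_cast mul_left_cancel₀ (mul_ne_zero two_ne_zero hr0) (add_left_cancel h)
  · exact_mod_cast hsq u
  · exact_mod_cast hT u v w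
  · exact_mod_cast hW u v w
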